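/- Consider the congested clique on the node set $\{u_1,\dots,u_n\}$: computation proceeds in synchronous rounds, in each round every node may send to every other node a (possibly different) message of $O(\log n)$ bits, each node has its own private independent fair random bits, local computation is unrestricted, and initially a node knows only $n$, its identifier and its neighbours in the input graph $G$, an undirected graph on $\{u_1,\dots,u_n\}$. A \emph{component} of $G$ is a nonempty set $C$ of nodes that induces a connected subgraph of $G$. It is \emph{active} if some edge of $G$ connects $C$ with its complement. Logarithms are to base $2$. There is a randomized algorithm in the congested clique that runs in $O(1)$ rounds and reduces the connected components problem for graphs $G$ of maximum degree at most $\log\log n$ to the connected components problem for the same graph $G$ together with a known partition into few active components. More precisely, there are constants $R,K,M$, a randomized congested clique algorithm that for every $n$ uses at most $R$ rounds and messages of at most $K\log n$ bits, and for every $n\ge 1$ a fixed node (depending only on $n$), such that for every $c\in\mathbb{N}$, for all sufficiently large $n$ (how large depends only on $c$) and for every graph $G$ on $n$ nodes with maximum degree at most $\log\log n$, the following holds with probability at least $1-n^{-c}$: at the end the fixed node knows a partition of the node set into components of $G$, at most $M\,n/\log\log n$ of which are active, together with a spanning tree, consisting of edges of $G$, of every component of the partition. -/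

import Mathlib

namespace CongestedClique

/-- A message of at most `b` bits. -/
abbrev Message (b : ℕ) : Type := {l : List Bool // l.length ≤ b}

/-- A randomized algorithm on the congested clique with node set `Fin n`.  Before each round a
node knows `n`, its own identifier, the set of its neighbours in the input graph, its private random
bits, and, for every earlier round, the message received from every node.  From this it computes the
message that it sends to each node.  After the last round it computes its output in the same way.
Local computation is unrestricted, as usual in this model. -/
structure Algorithm (n : ℕ) (Out : Type) where
  /-- the number of communication rounds -/
  rounds : ℕ
  /-- the largest number of bits of a message -/
  bandwidth : ℕ
  /-- the number of private random bits of each node -/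
  coins : ℕ
  /-- `send u nbrs ω hist v` is the message from `u` to `v` in round `hist.length`, counted from `0`;
  `hist` lists, round by round, the messages that `u` has received from each node. -/
  send : Fin n → Set (Fin n) → (Fin coins → Bool) → List (Fin n → Message bandwidth) →
    Fin n → Message bandwidth
  /-- `output u nbrs ω hist` is what `u` has computed at the end. -/
  output : Fin n → Set (Fin n) → (Fin coins → Bool) → List (Fin n → Message bandwidth) → Out

namespace Algorithm

variable {n : ℕ} {Out : Type}

/-- The random bits of all nodes. -/
abbrev Randomness (A : Algorithm n Out) : Type := Fin n → Fin A.coins → Bool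

/-- The messages received by each node in the first `r` rounds on the input graph `G`. -/
def history (A : Algorithm n Out) (G : SimpleGraph (Fin n)) (ω : A.Randomness) :
    ℕ → Fin n → List (Fin n → Message A.bandwidth)
  | 0, _ => []
  | r + 1, v => A.history G ω r v ++
      [fun u => A.send u (G.neighborSet u) (ω u) (A.history G ω r u) v]

/-- The output of node `v` on the input graph `G`. -/
def result (A : Algorithm n Out) (G : SimpleGraph (Fin n)) (ω : A.Randomness) (v : Fin n) : Out :=
  A.output v (G.neighborSet v) (ω v) (A.history G ω A.rounds v)

/-- The probability of an event, all random bits being independent and fair. -/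
noncomputable def prob (A : Algorithm n Out) (E : A.Randomness → Prop) : ℝ :=
  (Nat.card {ω : A.Randomness // E ω} : ℝ) / (Nat.card A.Randomness : ℝ)

end Algorithm

/-- A component of `G`: a nonempty set of nodes that induces a connected subgraph. -/
def IsComponent {n : ℕ} (G : SimpleGraph (Fin n)) (C : Finset (Fin n)) : Prop :=
  (G.induce (C : Set (Fin n))).Connected

/-- Some edge of `G` connects `C` with its complement. -/
def IsGrowable {n : ℕ} (G : SimpleGraph (Fin n)) (C : Finset (Fin n)) : Prop :=
  ∃ u ∈ C, ∃ v, v ∉ C ∧ G.Adj u v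

/-- The additional knowledge, held by one node, in an instance of the connected components problem
with a known partition: a partition of the node set, and a graph which is meant to be the union of
spanning trees of its parts. -/
structure KnownPartition (n : ℕ) where
  partition : Finpartition (Finset.univ : Finset (Fin n))
  forest : SimpleGraph (Fin n)

/-- `P` is a partition of the graph `G` into components, with a spanning tree of each of them. -/
structure KnownPartition.IsPartitionOf {n : ℕ} (P : KnownPartition n) (G : SimpleGraph (Fin n)) :
    Prop where
  isComponent : ∀ C ∈ P.partition.parts, IsComponent G C
  forest_le : P.forest ≤ G
  forest_within : ∀ u v, P.forest.Adj u v → P.partition.part u = P.partition.part v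
  isTree : ∀ C ∈ P.partition.parts, (P.forest.induce (C : Set (Fin n))).IsTree

/-- The number of active components of a known partition with respect to the input graph `G`. -/
noncomputable def KnownPartition.activeCount {n : ℕ} (P : KnownPartition n)
    (G : SimpleGraph (Fin n)) : ℕ :=
  {C : Finset (Fin n) | C ∈ P.partition.parts ∧ IsGrowable G C}.ncard

end CongestedClique

namespace CongestedClique

open Finset

/-! A deterministic three-round algorithm suffices. Let `q = ⌊log log n⌋`. A union bound over random
functions yields `n` hardwired maps `f i` from nodes to ports such that every assignment of ports to
`2 * q` nodes is realized by some `f i` (`exists_universal_family`). Node `u` tells node `i` the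
neighbour behind its port `f i u`, so node `i` knows a whole map `F i` on the nodes. It returns to
each `v` the largest node that `v` reaches in at most `2 * q` steps of `F i`, with the number of
steps left over (`bestKey`). Each `v` takes the best of these keys and announces its first step
towards the target, or itself if it is its own target.

The best key strictly increases along pointers, so the pointers form a forest. Some `F i` follows a
shortest path from `v` to any given node within distance `2 * q` (`exists_iterate_port_eq`), so a
root is the largest node of its `2 * q`-ball. Hence roots are more than `2 * q` apart and their
`q`-balls are disjoint. If the root of a tree has at most `q` nodes in its `q`-ball, that ball is
its whole connected component in `G`, which then has no other root, so the tree is not active. Thus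
active trees number at most `n / (q + 1)`. -/

/-! ### Universal families of port choices, by the probabilistic method -/

/-- If every set of a small family is dense in a finite type, then some sequence of given length
meets all of these sets. -/
theorem exists_sequence_meeting_all {α γ : Type*} [Fintype α] [Nonempty α] [Fintype γ]
    (n : ℕ) (s : γ → Finset α) (ε : ℝ) (hs : ∀ c, ε * Fintype.card α ≤ #(s c))
    (h : Fintype.card γ * (1 - ε) ^ n < 1) : ∃ f : Fin n → α, ∀ c, ∃ i, f i ∈ s c := by
  classical
  by_contra! hf
  -- Union bound: if no sequence works, the sequences that avoid a single `s c` already cover all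
  -- sequences.
  have hcover : (univ : Finset (Fin n → α)) ⊆
      univ.biUnion fun c => Fintype.piFinset fun _ => (s c)ᶜ := by
    intro f _
    obtain ⟨c, hc⟩ := hf f
    simpa using ⟨c, hc⟩
  have hα : (0 : ℝ) < Fintype.card α := by exact_mod_cast Fintype.card_pos
  have hcard : (Fintype.card α : ℝ) ^ n ≤ ∑ c : γ, (#(s c)ᶜ : ℝ) ^ n := by
    have := (card_le_card hcover).trans card_biUnion_le
    simp only [card_univ, Fintype.card_pi, Fintype.card_piFinset, prod_const,
      Fintype.card_fin] at this
    exact_mod_cast this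
  have hle : ∀ c : γ, (#(s c)ᶜ : ℝ) ^ n ≤ ((1 - ε) * Fintype.card α) ^ n := by
    intro c
    refine pow_le_pow_left₀ (by positivity) ?_ n
    rw [card_compl, Nat.cast_sub (card_le_univ _)]
    linarith [hs c]
  have hsum := hcard.trans (sum_le_sum fun c _ => hle c)
  rw [sum_const, card_univ, nsmul_eq_mul, mul_pow, ← mul_assoc] at hsum
  nlinarith [pow_pos hα n]

/-- The functions that agree with a given one at `r` points have density at least `q⁻ʳ`. -/
theorem card_le_mul_card_eq_on_range {V : Type*} [Fintype V] [DecidableEq V] {q r : ℕ} (hq : 0 < q)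
    (g : V → Fin q) (t : Fin r → V) :
    q ^ Fintype.card V ≤ q ^ r * #{a : V → Fin q | ∀ j, a (t j) = g (t j)} := by
  have hsub : (Fintype.piFinset fun v => if v ∈ univ.image t then {g v} else univ) ⊆
      ({a : V → Fin q | ∀ j, a (t j) = g (t j)} : Finset _) := by
    intro a ha
    simp only [mem_filter, mem_univ, true_and]
    intro j
    simpa using Fintype.mem_piFinset.mp ha (t j)
  have hcard : #(Fintype.piFinset fun v => if v ∈ univ.image t then {g v} else univ) =
      q ^ #(univ.image t)ᶜ := by
    rw [Fintype.card_piFinset, ← prod_mul_prod_compl (univ.image t)]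
    rw [prod_eq_one fun v hv => by rw [if_pos hv]; simp, one_mul,
      prod_eq_pow_card (b := q) fun v hv => by rw [if_neg (mem_compl.mp hv)]; simp]
  calc q ^ Fintype.card V = q ^ #(univ.image t) * q ^ #(univ.image t)ᶜ := by
        rw [← pow_add, card_add_card_compl]
    -- The points `t j` may repeat, so the image can have fewer than `r` elements.
    _ ≤ q ^ r * q ^ #(univ.image t)ᶜ := by
        gcongr
        simpa using card_image_le (s := univ) (f := t)
    _ ≤ _ := by
        rw [← hcard]
        exact Nat.mul_le_mul_left _ (card_le_card hsub)

/-- There are `n` functions on `n` points with `q` values that realize every pattern on every `r`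
points. -/
theorem exists_universal_family {n q r : ℕ} (hq : 0 < q)
    (h : ((n * q : ℕ) : ℝ) ^ r * (1 - 1 / (q : ℝ) ^ r) ^ n < 1) :
    ∃ f : Fin n → Fin n → Fin q, ∀ (g : Fin n → Fin q) (t : Fin r → Fin n),
      ∃ i, ∀ j, f i (t j) = g (t j) := by
  classical
  have : NeZero q := ⟨hq.ne'⟩
  -- Since points may repeat, only consistent patterns can be met; their number is still at most `(n
  -- * q) ^ r`.
  let γ := {c : Fin r → Fin n × Fin q // ∃ g : Fin n → Fin q, ∀ j, g (c j).1 = (c j).2}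
  let s : γ → Finset (Fin n → Fin q) := fun c => {a | ∀ j, a (c.1 j).1 = (c.1 j).2}
  have hqr : (0 : ℝ) < (q : ℝ) ^ r := by positivity
  have hγ : (Fintype.card γ : ℝ) ≤ ((n * q : ℕ) : ℝ) ^ r := by
    have := Fintype.card_subtype_le
      fun c : Fin r → Fin n × Fin q => ∃ g : Fin n → Fin q, ∀ j, g (c j).1 = (c j).2
    simp only [Fintype.card_fun, Fintype.card_prod, Fintype.card_fin] at this
    exact_mod_cast this
  have hq1 : (1 : ℝ) ≤ (q : ℝ) ^ r := one_le_pow₀ (by exact_mod_cast hq)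
  obtain ⟨f, hf⟩ := exists_sequence_meeting_all n s (1 / (q : ℝ) ^ r) (by
    rintro ⟨c, g, hg⟩
    have hc : s ⟨c, g, hg⟩ = ({a | ∀ j, a (c j).1 = g (c j).1} : Finset _) := by
      ext a; simp [s, hg]
    have := card_le_mul_card_eq_on_range hq g fun j => (c j).1
    rw [hc, one_div_mul_eq_div, div_le_iff₀' hqr]
    simp only [Fintype.card_fun, Fintype.card_fin] at this ⊢
    exact_mod_cast this) (lt_of_le_of_lt (mul_le_mul_of_nonneg_right hγ (pow_nonneg (by
      rw [sub_nonneg, div_le_one hqr]; exact hq1) n)) h)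
  refine ⟨f, fun g t => ?_⟩
  obtain ⟨i, hi⟩ := hf ⟨fun j => (t j, g (t j)), g, fun _ => rfl⟩
  exact ⟨i, by simpa [s] using hi⟩

/-- Source of the threshold 9, the least `q` from which the inequality persists. The left side is
the exponent in `8 * q * q ^ (2 * q) ≤ 2 ^ (2 * q ^ 2 + q + 3)`. -/
theorem two_mul_sq_add_lt_two_pow {q : ℕ} (hq : 9 ≤ q) : 2 * q ^ 2 + q + 3 < 2 ^ (q - 1) := by
  induction q, hq using Nat.le_induction with
  | base => norm_num
  | succ q hq ih =>
    obtain ⟨k, rfl⟩ : ∃ k, q = k + 1 := ⟨q - 1, by omega⟩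
    simp only [Nat.add_sub_cancel] at ih ⊢
    rw [pow_succ 2 k]
    nlinarith

/-- The bound under which random functions realize all patterns. -/
theorem pattern_count_mul_failure_lt_one {n q : ℕ} (hq : 9 ≤ q) (hn : 2 ^ 2 ^ q ≤ n) :
    ((n * q : ℕ) : ℝ) ^ (2 * q) * (1 - 1 / (q : ℝ) ^ (2 * q)) ^ n < 1 := by
  have hq2 : q < 2 ^ q := Nat.lt_two_pow_self
  have hqn : q ≤ n := hq2.le.trans (Nat.lt_two_pow_self.le.trans hn)
  have hn0 : (0 : ℝ) < n := by exact_mod_cast (by omega : 0 < n)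
  have hq0 : (0 : ℝ) < q := by exact_mod_cast (by omega : 0 < q)
  have hQ : (0 : ℝ) < (q : ℝ) ^ (2 * q) := by positivity
  have hsqrt : (2 : ℝ) ^ 2 ^ (q - 1) ≤ √n := by
    apply Real.le_sqrt_of_sq_le
    rw [← pow_mul, ← pow_succ, Nat.sub_add_cancel (by omega)]
    exact_mod_cast hn
  have hlog : Real.log n ≤ 2 * √n := by
    have h1 := Real.log_sqrt hn0.le
    have h2 := Real.log_le_sub_one_of_pos (Real.sqrt_pos.mpr hn0)
    linarith
  have hsmall : 8 * (q : ℝ) * (q : ℝ) ^ (2 * q) < √n := by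
    refine lt_of_lt_of_le ?_ hsqrt
    have : 8 * q * q ^ (2 * q) < 2 ^ 2 ^ (q - 1) :=
      calc 8 * q * q ^ (2 * q) ≤ 2 ^ 3 * 2 ^ q * (2 ^ q) ^ (2 * q) := by gcongr; norm_num
        _ = 2 ^ (2 * q ^ 2 + q + 3) := by rw [← pow_mul, ← pow_add, ← pow_add]; ring_nf
        _ < _ := Nat.pow_lt_pow_right (by norm_num) (two_mul_sq_add_lt_two_pow hq)
    exact_mod_cast this
  have hexp : (1 - 1 / (q : ℝ) ^ (2 * q)) ^ n ≤ Real.exp (-(n / (q : ℝ) ^ (2 * q))) := by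
    have hle : 1 - 1 / (q : ℝ) ^ (2 * q) ≤ Real.exp (-(1 / (q : ℝ) ^ (2 * q))) :=
      Real.one_sub_le_exp_neg _
    have h0 : 0 ≤ 1 - 1 / (q : ℝ) ^ (2 * q) := by
      rw [sub_nonneg, div_le_one hQ]
      exact one_le_pow₀ (by exact_mod_cast (by omega : 1 ≤ q))
    calc _ ≤ Real.exp (-(1 / (q : ℝ) ^ (2 * q))) ^ n := pow_le_pow_left₀ h0 hle n
      _ = _ := by rw [← Real.exp_nat_mul]; ring_nf
  have hpow : ((n * q : ℕ) : ℝ) ^ (2 * q) ≤ Real.exp (4 * q * Real.log n) := by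
    calc ((n * q : ℕ) : ℝ) ^ (2 * q) ≤ ((n : ℝ) ^ 2) ^ (2 * q) := by
          gcongr
          rw [sq]
          exact_mod_cast Nat.mul_le_mul_left n hqn
      _ = Real.exp (4 * q * Real.log n) := by
          rw [← pow_mul, mul_comm (4 * (q : ℝ)), Real.exp_mul, Real.exp_log hn0,
            ← Real.rpow_natCast]
          push_cast; ring_nf
  -- `log n ≤ 2 * √n` costs one factor `√n`; the other absorbs `8 * q * q ^ (2 * q)`.
  have hkey : 4 * (q : ℝ) * Real.log n < n / (q : ℝ) ^ (2 * q) := by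
    rw [lt_div_iff₀ hQ]
    calc 4 * (q : ℝ) * Real.log n * (q : ℝ) ^ (2 * q)
        ≤ 4 * (q : ℝ) * (2 * √n) * (q : ℝ) ^ (2 * q) := by gcongr
      _ = (8 * (q : ℝ) * (q : ℝ) ^ (2 * q)) * √n := by ring
      _ < √n * √n := by gcongr
      _ = n := Real.mul_self_sqrt hn0.le
  calc _ ≤ Real.exp (4 * q * Real.log n) * Real.exp (-(n / (q : ℝ) ^ (2 * q))) :=
        mul_le_mul hpow hexp (by
          apply pow_nonneg
          rw [sub_nonneg, div_le_one hQ]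
          exact one_le_pow₀ (by exact_mod_cast (by omega : 1 ≤ q))) (Real.exp_pos _).le
    _ < 1 := by
        rw [← Real.exp_add, Real.exp_lt_one_iff]
        linarith

/-! ### Forests of pointers along which a potential increases -/

/-- The graph that joins every node with the node it points to. -/
def pointerGraph {V : Type*} (P : V → V) : SimpleGraph V := SimpleGraph.fromRel fun u v => P u = v

section PointerGraph

variable {V K : Type*} {P : V → V} {G : SimpleGraph V}

theorem pointerGraph_le (hG : ∀ v, P v ≠ v → G.Adj v (P v)) : pointerGraph P ≤ G := by
  rintro u v ⟨huv, rfl | rfl⟩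
  · exact hG u huv.symm
  · exact (hG v huv).symm

/-- At a node of a cycle with minimal `B`, neither cycle edge can be an incoming pointer, so both
lead to `P v`; but the two neighbours on a cycle differ. -/
theorem pointerGraph_isAcyclic [LinearOrder K] {B : V → K} (hB : ∀ v, P v ≠ v → B v < B (P v)) :
    (pointerGraph P).IsAcyclic := by
  classical
  intro u c hc
  obtain ⟨v, hv, hmin⟩ := c.support.toFinset.exists_min_image B ⟨u, by simp⟩
  have hv' : v ∈ c.support := by simpa using hv
  have hcyc := hc.rotate hv'
  have hmem : ∀ x ∈ (c.rotate v hv').support, B v ≤ B x := fun x hx =>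
    hmin x (by simpa using (SimpleGraph.Walk.mem_support_rotate_iff c v hv').mp hx)
  have hadj : ∀ x, (pointerGraph P).Adj v x → B v ≤ B x → P v = x := by
    rintro x ⟨hne, h | rfl⟩ hle
    · exact h
    · exact absurd (hB x hne) (not_lt.mpr hle)
  refine hcyc.snd_ne_penultimate ?_
  rw [← hadj _ (SimpleGraph.Walk.adj_snd hcyc.not_nil)
      (hmem _ (SimpleGraph.Walk.getVert_mem_support _ _)),
    ← hadj _ (SimpleGraph.Walk.adj_penultimate hcyc.not_nil).symm
      (hmem _ (SimpleGraph.Walk.getVert_mem_support _ _))]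

theorem exists_fixed_reachable [Finite V] [LinearOrder K] {B : V → K}
    (hB : ∀ v, P v ≠ v → B v < B (P v)) (v : V) :
    ∃ x, P x = x ∧ (pointerGraph P).Reachable v x := by
  classical
  cases nonempty_fintype V
  obtain ⟨x, hx, hmax⟩ := ({x | (pointerGraph P).Reachable v x} : Finset V).exists_max_image B
    ⟨v, by simp⟩
  simp only [mem_filter, mem_univ, true_and] at hx hmax
  refine ⟨x, by_contra fun hne => ?_, hx⟩
  have hadj : (pointerGraph P).Adj x (P x) := ⟨Ne.symm hne, Or.inl rfl⟩
  exact absurd (hB x hne) (not_lt.mpr (hmax _ (hx.trans hadj.reachable)))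

end PointerGraph

/-! ### Separated roots and the number of active components -/

/-- A node that reaches a node at distance more than `q` has more than `q` nodes in its `q`-ball. -/
theorem lt_card_ball {V : Type*} [Fintype V] {G : SimpleGraph V} {u v : V} {q : ℕ}
    [DecidablePred fun x => G.edist u x ≤ q]
    (h : G.Reachable u v) (hd : q < G.edist u v) : q + 1 ≤ #{x | G.edist u x ≤ q} := by
  obtain ⟨p, hp⟩ := h.exists_walk_length_eq_dist
  have hpath := p.isPath_of_length_eq_dist hp
  have hq : q < p.length := by
    rw [← h.coe_dist_eq_edist] at hd
    rw [hp]
    exact_mod_cast hd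
  calc q + 1 = #(range (q + 1)) := (card_range _).symm
    -- The first `q + 1` nodes of a shortest path are distinct and lie in the ball.
    _ ≤ _ := card_le_card_of_injOn p.getVert ?_ ?_
  · intro i hi
    have hi' : i ≤ q := by simpa [Nat.lt_succ_iff] using hi
    have := SimpleGraph.edist_le (p.take i)
    simp only [coe_filter, mem_univ, true_and, Set.mem_ofPred_eq]
    refine this.trans ?_
    rw [SimpleGraph.Walk.take_length]
    exact_mod_cast (min_le_left _ _).trans hi'
  · intro i hi j hj hij
    simp only [coe_range, Set.mem_Iio] at hi hj
    exact hpath.getVert_injOn (by simp; omega) (by simp; omega) hij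

/-- Distinct nodes of a `2 * q`-separated set whose `q`-balls are large are few. -/
theorem card_mul_le_of_separated {V : Type*} [Fintype V] {G : SimpleGraph V} {q : ℕ}
    [∀ u, DecidablePred fun x => G.edist u x ≤ q] (S : Finset V)
    (hsep : ∀ u ∈ S, ∀ v ∈ S, G.edist u v ≤ (2 * q : ℕ) → u = v)
    (hball : ∀ u ∈ S, q + 1 ≤ #{x | G.edist u x ≤ q}) : #S * (q + 1) ≤ Fintype.card V := by
  classical
  calc #S * (q + 1) ≤ ∑ u ∈ S, #{x | G.edist u x ≤ q} := by
        simpa using card_nsmul_le_sum S _ (q + 1) hball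
    _ = #(S.biUnion fun u => ({x | G.edist u x ≤ q} : Finset V)) := by
        refine (card_biUnion fun u hu v hv huv => ?_).symm
        rw [Function.onFun, Finset.disjoint_left]
        intro x hx hx'
        simp only [mem_filter, mem_univ, true_and] at hx hx'
        refine huv (hsep u hu v hv (SimpleGraph.edist_triangle (v := x) |>.trans ?_))
        rw [SimpleGraph.edist_comm (u := x)]
        calc _ ≤ (q : ℕ∞) + q := add_le_add hx hx'
          _ = _ := by rw [two_mul]; rfl
    _ ≤ _ := card_le_univ _

open Classical in
/-- The partition into the components of the pointer graph, with the pointers as spanning trees. -/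
noncomputable def KnownPartition.ofPointers {n : ℕ} (P : Fin n → Fin n) : KnownPartition n where
  partition := Finpartition.ofSetoid (pointerGraph P).reachableSetoid
  forest := pointerGraph P

section OfPointers

variable {n : ℕ} {P : Fin n → Fin n} {G : SimpleGraph (Fin n)} {K : Type*} [LinearOrder K]
  {B : Fin n → K}

theorem KnownPartition.mem_part_ofPointers {u v : Fin n} :
    v ∈ (ofPointers P).partition.part u ↔ (pointerGraph P).Reachable u v := by
  classical
  exact Finpartition.mem_part_ofSetoid_iff_rel

theorem KnownPartition.exists_supp_eq_of_mem_parts {C : Finset (Fin n)}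
    (hC : C ∈ (ofPointers P).partition.parts) :
    ∃ c : (pointerGraph P).ConnectedComponent, (C : Set (Fin n)) = c.supp := by
  obtain ⟨u, hu⟩ := (ofPointers P).partition.nonempty_of_mem_parts hC
  refine ⟨(pointerGraph P).connectedComponentMk u, ?_⟩
  ext v
  rw [← (ofPointers P).partition.part_eq_of_mem hC hu, mem_coe, mem_part_ofPointers,
    SimpleGraph.ConnectedComponent.mem_supp_iff, SimpleGraph.ConnectedComponent.eq]
  exact SimpleGraph.reachable_comm

theorem KnownPartition.isPartitionOf_ofPointers (hG : ∀ v, P v ≠ v → G.Adj v (P v))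
    (hB : ∀ v, P v ≠ v → B v < B (P v)) : (ofPointers P).IsPartitionOf G := by
  have hconn : ∀ C ∈ (ofPointers P).partition.parts,
      ((pointerGraph P).induce (C : Set (Fin n))).Connected := by
    intro C hC
    obtain ⟨c, hc⟩ := exists_supp_eq_of_mem_parts hC
    rw [hc]
    exact c.connected_toSimpleGraph
  refine ⟨fun C hC => ?_, pointerGraph_le hG, fun u v huv => ?_, fun C hC => ?_⟩
  · exact (hconn C hC).mono fun _ _ h => pointerGraph_le hG h
  · rw [← Finpartition.mem_part_iff_part_eq_part _ (mem_univ u) (mem_univ v), mem_part_ofPointers]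
    exact huv.symm.reachable
  · exact ⟨hconn C hC, (pointerGraph_isAcyclic hB).induce _⟩

theorem KnownPartition.activeCount_ofPointers_mul_le {q : ℕ}
    (hG : ∀ v, P v ≠ v → G.Adj v (P v)) (hB : ∀ v, P v ≠ v → B v < B (P v))
    (hsep : ∀ u v, P u = u → P v = v → G.edist u v ≤ (2 * q : ℕ) → u = v) :
    (ofPointers P).activeCount G * (q + 1) ≤ n := by
  classical
  have hle := pointerGraph_le hG
  have hroot : ∀ C ∈ (ofPointers P).partition.parts, ∃ x ∈ C, P x = x := by
    intro C hC
    obtain ⟨u, hu⟩ := (ofPointers P).partition.nonempty_of_mem_parts hC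
    obtain ⟨x, hx, hux⟩ := exists_fixed_reachable hB u
    rw [← mem_part_ofPointers, (ofPointers P).partition.part_eq_of_mem hC hu] at hux
    exact ⟨x, hux, hx⟩
  let S : Finset (Finset (Fin n)) := {C ∈ (ofPointers P).partition.parts | IsGrowable G C}
  have hS : (ofPointers P).activeCount G = #S := by
    rw [activeCount, ← Set.ncard_coe_finset]
    simp [S]
  rw [hS]
  rcases S.eq_empty_or_nonempty with hempty | ⟨C₀, hC₀⟩
  · simp [hempty]
  have : Nonempty (Fin n) := ⟨(hroot C₀ (mem_filter.mp hC₀).1).choose⟩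
  choose! root hrootmem hrootfix using hroot
  have hinj : Set.InjOn root (S : Set (Finset (Fin n))) := by
    intro C hC D hD h
    have hC' := (mem_filter.mp hC).1
    have hD' := (mem_filter.mp hD).1
    exact (ofPointers P).partition.eq_of_mem_parts hC' hD' (hrootmem C hC') (h ▸ hrootmem D hD')
  rw [← card_image_of_injOn hinj]
  refine (card_mul_le_of_separated (G := G) (S.image root) ?_ ?_).trans (Fintype.card_fin n).le
  · simp only [mem_image, S, mem_filter]
    rintro _ ⟨C, ⟨hC, -⟩, rfl⟩ _ ⟨D, ⟨hD, -⟩, rfl⟩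
    exact hsep _ _ (hrootfix C hC) (hrootfix D hD)
  · simp only [mem_image, S, mem_filter]
    rintro _ ⟨C, ⟨hC, u, hu, v, hv, huv⟩, rfl⟩
    by_contra hsmall
    -- A small ball contains everything reachable, including the root `x` of the part of `v`;
    -- separation forces `x = root C`, so the edge does not leave `C`.
    have hnear : ∀ x, G.Reachable (root C) x → G.edist (root C) x ≤ q := fun x hx =>
      not_lt.mp fun h => hsmall (lt_card_ball hx h)
    have hpart := (ofPointers P).partition.part_eq_of_mem hC (hrootmem C hC)
    have hCu : G.Reachable (root C) u :=
      (mem_part_ofPointers.mp (hpart.symm ▸ hu)).mono hle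
    obtain ⟨x, hx, hvx⟩ := exists_fixed_reachable hB v
    have hCx : G.Reachable (root C) x := (hCu.trans huv.reachable).trans (hvx.mono hle)
    have hxC : root C = x := hsep _ _ (hrootfix C hC) hx
      ((hnear x hCx).trans (by exact_mod_cast (by omega : q ≤ 2 * q)))
    refine hv ?_
    rw [← hpart, mem_part_ofPointers, hxC]
    exact hvx.symm

end OfPointers

/-! ### Port numberings and shortest paths -/

section Ports

variable {V : Type*} {q : ℕ}

theorem exists_ports [Finite V] (u : V) (S : Set V) (hS : S.ncard ≤ q) :
    ∃ p : Fin q → V, (∀ a, p a = u ∨ p a ∈ S) ∧ ∀ w ∈ S, ∃ a, p a = w := by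
  classical
  cases nonempty_fintype V
  obtain ⟨e⟩ : Nonempty (S ↪ Fin q) := Function.Embedding.nonempty_of_card_le (by
    rwa [Fintype.card_fin, ← Nat.card_eq_fintype_card, Nat.card_coe_set_eq])
  refine ⟨fun a => if h : ∃ w, e w = a then h.choose else u, fun a => ?_, fun w hw => ?_⟩
  · by_cases h : ∃ w, e w = a
    · right
      simp only [dif_pos h]
      exact h.choose.2
    · left
      simp only [dif_neg h]
  · have h : ∃ w', e w' = e ⟨w, hw⟩ := ⟨_, rfl⟩
    refine ⟨e ⟨w, hw⟩, ?_⟩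
    simp only [dif_pos h]
    exact congrArg Subtype.val (e.injective h.choose_spec)

open Classical in
/-- A numbering, by `q` ports, of a set of at most `q` neighbours of `u`; idle ports lead to `u`. -/
noncomputable def port (q : ℕ) (u : V) (S : Set V) : Fin q → V :=
  if h : ∃ p : Fin q → V, (∀ a, p a = u ∨ p a ∈ S) ∧ ∀ w ∈ S, ∃ a, p a = w then h.choose
  else fun _ => u

theorem port_spec [Finite V] (u : V) (S : Set V) (hS : S.ncard ≤ q) :
    (∀ a, port q u S a = u ∨ port q u S a ∈ S) ∧ ∀ w ∈ S, ∃ a, port q u S a = w := by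
  have h := exists_ports u S hS
  rw [port, dif_pos h]
  exact h.choose_spec

end Ports

theorem exists_adj_dist_add_one_eq {V : Type*} {G : SimpleGraph V} {u m : V}
    (h : G.Reachable u m) (hne : u ≠ m) : ∃ w, G.Adj u w ∧ G.dist w m + 1 = G.dist u m := by
  obtain ⟨p, hp⟩ := h.exists_walk_length_eq_dist
  cases p with
  | nil => exact absurd rfl hne
  | @cons _ w _ hadj p =>
    refine ⟨w, hadj, le_antisymm ?_ ?_⟩
    · rw [← hp, SimpleGraph.Walk.length_cons]
      exact Nat.succ_le_succ (SimpleGraph.dist_le p)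
    · obtain ⟨p', hp'⟩ := p.reachable.exists_walk_length_eq_dist
      rw [← hp']
      exact SimpleGraph.dist_le (SimpleGraph.Walk.cons hadj p')

/-- If the choices of ports realize all patterns on `r` nodes, then some choice leads along a
shortest path from `v` to `m`. -/
theorem exists_iterate_port_eq {V ι : Type*} [Finite V] {G : SimpleGraph V} {q r : ℕ} (hq : 0 < q)
    (hdeg : ∀ v, (G.neighborSet v).ncard ≤ q) {f : ι → V → Fin q}
    (hf : ∀ (g : V → Fin q) (t : Fin r → V), ∃ i, ∀ j, f i (t j) = g (t j))
    {v m : V} (hvm : G.edist v m ≤ r) :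
    ∃ d ≤ r, ∃ i, (fun u => port q u (G.neighborSet u) (f i u))^[d] v = m := by
  classical
  have hreach : G.Reachable v m :=
    SimpleGraph.reachable_of_edist_ne_top (ne_top_of_le_ne_top (ENat.natCast_ne_top r) hvm)
  have hdr : G.dist v m ≤ r := by
    rw [← hreach.coe_dist_eq_edist] at hvm
    exact_mod_cast hvm
  have hnext : ∀ u, ∃ a : Fin q, G.Reachable u m → u ≠ m →
      G.Adj u (port q u (G.neighborSet u) a) ∧
        G.dist (port q u (G.neighborSet u) a) m + 1 = G.dist u m := by
    intro u
    by_cases h : G.Reachable u m ∧ u ≠ m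
    · obtain ⟨w, hw, hd⟩ := exists_adj_dist_add_one_eq h.1 h.2
      obtain ⟨a, rfl⟩ := (port_spec u _ (hdeg u)).2 w hw
      exact ⟨a, fun _ _ => ⟨hw, hd⟩⟩
    · exact ⟨⟨0, hq⟩, fun h₁ h₂ => absurd ⟨h₁, h₂⟩ h⟩
  choose g hg using hnext
  set next : V → V := fun u => port q u (G.neighborSet u) (g u) with hnextdef
  have hpath : ∀ j ≤ G.dist v m,
      G.Reachable (next^[j] v) m ∧ G.dist (next^[j] v) m + j = G.dist v m := by
    intro j
    induction j with
    | zero => exact fun _ => ⟨hreach, rfl⟩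
    | succ j ih =>
      intro hj
      obtain ⟨h₁, h₂⟩ := ih (by omega)
      have hne : next^[j] v ≠ m := by
        intro h
        rw [h, SimpleGraph.dist_self] at h₂
        omega
      obtain ⟨h₃, h₄⟩ := hg _ h₁ hne
      rw [Function.iterate_succ_apply']
      exact ⟨h₃.symm.reachable.trans h₁, by simp only [hnextdef] at h₂ h₄ ⊢; omega⟩
  -- A path of length at most `r` takes its steps from at most `r` nodes; agreement with `g` at
  -- these is enough, as the endpoint needs no port.
  obtain ⟨i, hi⟩ := hf g fun j : Fin r => next^[j] v
  refine ⟨G.dist v m, hdr, i, ?_⟩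
  have hsame : ∀ j ≤ G.dist v m,
      (fun u => port q u (G.neighborSet u) (f i u))^[j] v = next^[j] v := by
    intro j
    induction j with
    | zero => exact fun _ => rfl
    | succ j ih =>
      intro hj
      rw [Function.iterate_succ_apply', Function.iterate_succ_apply', ih (by omega)]
      exact congrArg (port q (next^[j] v) _) (hi ⟨j, by omega⟩)
  obtain ⟨h₁, h₂⟩ := hpath _ le_rfl
  rw [hsame _ le_rfl]
  exact h₁.dist_eq_zero_iff.mp (by omega)

/-! ### Keys as a potential for the pointers -/

section Keys

variable {V ι : Type*} [LinearOrder V] {r : ℕ}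

/-- The largest node within `r` steps from `v` under `F`, together with the largest number of steps
that can be left when it is reached. -/
def bestKey (r : ℕ) (F : V → V) (v : V) : V ×ₗ Fin (r + 1) :=
  univ.sup' univ_nonempty fun t : Fin (r + 1) => toLex (F^[r - t] v, t)

theorem le_bestKey (F : V → V) (v : V) (t : Fin (r + 1)) :
    toLex (F^[r - t] v, t) ≤ bestKey r F v :=
  le_sup' (fun t : Fin (r + 1) => toLex (F^[r - t] v, t)) (mem_univ t)

theorem exists_bestKey_eq (r : ℕ) (F : V → V) (v : V) :
    ∃ t : Fin (r + 1), bestKey r F v = toLex (F^[r - t] v, t) := by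
  obtain ⟨t, -, ht⟩ := exists_mem_eq_sup' univ_nonempty
    fun t : Fin (r + 1) => (toLex (F^[r - t] v, t) : V ×ₗ Fin (r + 1))
  exact ⟨t, ht⟩

/-- The key improves along a step towards the largest node. -/
theorem bestKey_lt_bestKey_apply {F : V → V} {v : V} (h : (ofLex (bestKey r F v)).1 ≠ v) :
    bestKey r F v < bestKey r F (F v) := by
  obtain ⟨t, ht⟩ := exists_bestKey_eq r F v
  rw [ht] at h ⊢
  -- If all `r` steps were left, the target would be `v` itself. So a step is used, and from `F v`
  -- the same target is reached with one more step left.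
  have htr : (t : ℕ) < r := by
    by_contra hle
    have : r - (t : ℕ) = 0 := by omega
    simp [this] at h
  refine lt_of_lt_of_le ?_ (le_bestKey F (F v) ⟨t + 1, by omega⟩)
  have hstep : F^[r - (t + 1 : ℕ)] (F v) = F^[r - t] v := by
    rw [← Function.iterate_succ_apply]
    congr 2
    omega
  simp only [hstep]
  rw [Prod.Lex.toLex_lt_toLex]
  exact Or.inr ⟨rfl, Fin.lt_def.mpr (Nat.lt_succ_self _)⟩

variable [Fintype ι] [Nonempty ι]

/-- The best of the keys of `v` under a family of maps. -/
def familyKey (r : ℕ) (F : ι → V → V) (v : V) : V ×ₗ Fin (r + 1) :=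
  univ.sup' univ_nonempty fun i => bestKey r (F i) v

theorem bestKey_le_familyKey (F : ι → V → V) (i : ι) (v : V) :
    bestKey r (F i) v ≤ familyKey r F v :=
  le_sup' (fun i => bestKey r (F i) v) (mem_univ i)

/-- The pointer of `v`, computed from its image and its key under each map of a family. -/
noncomputable def pointer {ι : Type*} [Nonempty ι] (v : V) (x : ι → V)
    (k : ι → V ×ₗ Fin (r + 1)) : V :=
  let i := Classical.epsilon fun i => ∀ j, k j ≤ k i
  if (ofLex (k i)).1 = v then v else x i

/-- The pointer of each node under a family of maps. -/
noncomputable def familyPointer (r : ℕ) (F : ι → V → V) (v : V) : V :=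
  pointer v (fun i => F i v) fun i => bestKey r (F i) v

/-- A step along the maximizing map improves its key, and `familyKey` at the new node dominates that
key, even if another map is best there. Hence `familyKey` is a potential for pointers taken from
different maps. -/
theorem familyPointer_eq_self_or (F : ι → V → V) (v : V) :
    (ofLex (familyKey r F v)).1 = v ∧ familyPointer r F v = v ∨
      (∃ i, familyPointer r F v = F i v) ∧
        familyKey r F v < familyKey r F (familyPointer r F v) := by
  obtain ⟨i₀, -, hi₀⟩ := exists_max_image univ (fun i => bestKey r (F i) v) univ_nonempty
  have hmax := Classical.epsilon_spec (p := fun i => ∀ j, bestKey r (F j) v ≤ bestKey r (F i) v)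
    ⟨i₀, fun j => hi₀ j (mem_univ j)⟩
  rw [familyPointer, pointer]
  set i := Classical.epsilon fun i => ∀ j, bestKey r (F j) v ≤ bestKey r (F i) v
  have hkey : familyKey r F v = bestKey r (F i) v :=
    le_antisymm (sup'_le _ _ fun j _ => hmax j) (bestKey_le_familyKey F i v)
  rw [hkey]
  by_cases h : (ofLex (bestKey r (F i) v)).1 = v
  · exact Or.inl ⟨h, if_pos h⟩
  · right
    simp only [if_neg h]
    exact ⟨⟨i, rfl⟩, (bestKey_lt_bestKey_apply h).trans_le (bestKey_le_familyKey F i _)⟩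

theorem familyKey_lt_of_ne {F : ι → V → V} {v : V} (h : familyPointer r F v ≠ v) :
    familyKey r F v < familyKey r F (familyPointer r F v) :=
  (familyPointer_eq_self_or F v).elim (fun h' => absurd h'.2 h) And.right

theorem exists_familyPointer_eq {F : ι → V → V} {v : V} (h : familyPointer r F v ≠ v) :
    ∃ i, familyPointer r F v = F i v :=
  (familyPointer_eq_self_or F v).elim (fun h' => absurd h'.2 h) And.left

theorem fst_familyKey_eq {F : ι → V → V} {v : V} (h : familyPointer r F v = v) :
    (ofLex (familyKey r F v)).1 = v := by
  rcases familyPointer_eq_self_or (r := r) F v with h' | ⟨-, h'⟩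
  · exact h'.1
  · rw [h] at h'
    exact absurd h' (lt_irrefl _)

/-- A node that points to itself is the largest node that it reaches in at most `r` steps. -/
theorem le_of_familyPointer_eq_self {F : ι → V → V} {u v : V} (h : familyPointer r F u = u)
    {d : ℕ} (hd : d ≤ r) {i : ι} (hi : (F i)^[d] u = v) : v ≤ u := by
  have hle := (le_bestKey (r := r) (F i) u ⟨r - d, by omega⟩).trans (bestKey_le_familyKey F i u)
  have := Prod.Lex.monotone_fst _ _ hle
  rw [fst_familyKey_eq h] at this
  simpa [Nat.sub_sub_self hd, hi] using this

end Keys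

/-! ### Communication and message sizes -/

section ThreeRounds

theorem nonempty_embedding_message {X : Type*} [Fintype X] {b : ℕ} (h : Fintype.card X ≤ 2 ^ b) :
    Nonempty (X ↪ Message b) := by
  obtain ⟨e⟩ : Nonempty (X ↪ List.Vector Bool b) :=
    Function.Embedding.nonempty_of_card_le (by simpa using h)
  exact ⟨e.trans ⟨fun l => ⟨l.1, l.2.le⟩, fun l l' hl =>
    Subtype.ext (Subtype.mk.inj hl)⟩⟩

variable {n b : ℕ} {X₀ X₁ X₂ Out : Type} [Nonempty X₀] [Nonempty X₁] [Nonempty X₂]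

/-- A deterministic algorithm with three rounds, with messages in arbitrary types that embed into the
bit strings.  In the second round, a node uses only what it has received in the first round, and in
the third round what it has received in the second round. -/
noncomputable def threeRounds (e₀ : X₀ ↪ Message b) (e₁ : X₁ ↪ Message b) (e₂ : X₂ ↪ Message b)
    (s₀ : Fin n → Set (Fin n) → Fin n → X₀) (s₁ : (Fin n → X₀) → Fin n → X₁)
    (s₂ : Fin n → Set (Fin n) → (Fin n → X₁) → X₂) (out : (Fin n → X₂) → Out) :
    Algorithm n Out where
  rounds := 3
  bandwidth := b
  coins := 0
  send u S _ hist v := match hist with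
    | [] => e₀ (s₀ u S v)
    | [h₀] => e₁ (s₁ (fun w => Function.invFun e₀ (h₀ w)) v)
    | _ :: h₁ :: _ => e₂ (s₂ u S fun w => Function.invFun e₁ (h₁ w))
  output _ _ _ hist := match hist with
    | [_, _, h₂] => out fun w => Function.invFun e₂ (h₂ w)
    -- Never reached: the history has length three when the output is computed.
    | _ => out fun _ => Classical.arbitrary X₂

theorem threeRounds_result (e₀ : X₀ ↪ Message b) (e₁ : X₁ ↪ Message b) (e₂ : X₂ ↪ Message b)
    (s₀ : Fin n → Set (Fin n) → Fin n → X₀) (s₁ : (Fin n → X₀) → Fin n → X₁)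
    (s₂ : Fin n → Set (Fin n) → (Fin n → X₁) → X₂) (out : (Fin n → X₂) → Out)
    (G : SimpleGraph (Fin n)) (ω : (threeRounds e₀ e₁ e₂ s₀ s₁ s₂ out).Randomness) (v : Fin n) :
    (threeRounds e₀ e₁ e₂ s₀ s₁ s₂ out).result G ω v =
      out fun w => s₂ w (G.neighborSet w) fun i => s₁ (fun u => s₀ u (G.neighborSet u) i) w := by
  have h₀ := Function.leftInverse_invFun e₀.injective
  have h₁ := Function.leftInverse_invFun e₁.injective
  have h₂ := Function.leftInverse_invFun e₂.injective
  simp only [Algorithm.result, threeRounds, Algorithm.history, List.nil_append, List.cons_append,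
    h₀ _, h₁ _, h₂ _]

end ThreeRounds

theorem le_two_pow_two_mul_log (n : ℕ) : n ≤ 2 ^ (2 * Nat.log 2 n) := by
  rcases lt_or_ge n 2 with h | h
  · exact (by omega : n ≤ 1).trans Nat.one_le_two_pow
  · have : 0 < Nat.log 2 n := Nat.log_pos one_lt_two h
    exact (Nat.lt_pow_succ_log_self one_lt_two n).le.trans
      (Nat.pow_le_pow_right two_pos (by omega))

/-- A three-round algorithm for graphs of maximum degree at most `q`. -/
theorem exists_algorithm_of_degree_le {n q : ℕ} (hq : 9 ≤ q) (hn : 2 ^ 2 ^ q ≤ n) :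
    ∃ A : Algorithm n (KnownPartition n), A.rounds = 3 ∧ A.bandwidth = 4 * Nat.log 2 n ∧
      ∀ G : SimpleGraph (Fin n), (∀ v, (G.neighborSet v).ncard ≤ q) → ∀ ω v,
        (A.result G ω v).IsPartitionOf G ∧ (A.result G ω v).activeCount G * (q + 1) ≤ n := by
  have hn0 : 0 < n := (Nat.two_pow_pos _).trans_le hn
  have : Nonempty (Fin n) := ⟨⟨0, hn0⟩⟩
  -- This makes a key one of at most `n * n` values, which fit into `4 * Nat.log 2 n` bits.
  have hrn : 2 * q + 1 ≤ n := by
    have h1 := two_mul_sq_add_lt_two_pow hq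
    have h2 : 2 ^ (q - 1) ≤ 2 ^ q := Nat.pow_le_pow_right two_pos (by omega)
    have h3 : 2 ^ q < 2 ^ 2 ^ q := Nat.lt_two_pow_self
    nlinarith
  have hpow : n * n ≤ 2 ^ (4 * Nat.log 2 n) := by
    calc n * n ≤ 2 ^ (2 * Nat.log 2 n) * 2 ^ (2 * Nat.log 2 n) :=
          Nat.mul_le_mul (le_two_pow_two_mul_log n) (le_two_pow_two_mul_log n)
      _ = _ := by rw [← pow_add]; ring_nf
  obtain ⟨e⟩ : Nonempty (Fin n ↪ Message (4 * Nat.log 2 n)) := nonempty_embedding_message (by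
    rw [Fintype.card_fin]
    exact (Nat.le_mul_of_pos_left n hn0).trans hpow)
  obtain ⟨e'⟩ : Nonempty (Fin n ×ₗ Fin (2 * q + 1) ↪ Message (4 * Nat.log 2 n)) :=
    nonempty_embedding_message (by
      rw [Fintype.card_lex, Fintype.card_prod, Fintype.card_fin, Fintype.card_fin]
      exact (Nat.mul_le_mul_left n hrn).trans hpow)
  obtain ⟨f, hf⟩ := exists_universal_family (r := 2 * q) (by omega)
    (pattern_count_mul_failure_lt_one hq hn)
  refine ⟨threeRounds e e' e (fun u S i => port q u S (f i u)) (bestKey (2 * q))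
    (fun v S k => pointer v (fun i => port q v S (f i v)) k) KnownPartition.ofPointers,
    rfl, rfl, fun G hG ω v => ?_⟩
  rw [threeRounds_result]
  set F : Fin n → Fin n → Fin n := fun i u => port q u (G.neighborSet u) (f i u)
  change (KnownPartition.ofPointers (familyPointer (2 * q) F)).IsPartitionOf G ∧
    (KnownPartition.ofPointers (familyPointer (2 * q) F)).activeCount G * (q + 1) ≤ n
  have hadj : ∀ v, familyPointer (2 * q) F v ≠ v → G.Adj v (familyPointer (2 * q) F v) := by
    intro v hv
    obtain ⟨i, hi⟩ := exists_familyPointer_eq hv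
    rw [hi] at hv ⊢
    exact ((port_spec v _ (hG v)).1 (f i v)).resolve_left hv
  have hle : ∀ u v, familyPointer (2 * q) F u = u → G.edist u v ≤ (2 * q : ℕ) → v ≤ u := by
    intro u v hu huv
    obtain ⟨d, hd, i, hi⟩ := exists_iterate_port_eq (by omega) hG hf huv
    exact le_of_familyPointer_eq_self hu hd hi
  exact ⟨KnownPartition.isPartitionOf_ofPointers hadj fun _ => familyKey_lt_of_ne,
    KnownPartition.activeCount_ofPointers_mul_le hadj (fun _ => familyKey_lt_of_ne)
      fun u v hu hv huv => le_antisymm (hle v u hv (SimpleGraph.edist_comm.trans_le huv))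
        (hle u v hu huv)⟩

/-! ### Passage to the asymptotic statement -/

theorem Algorithm.prob_eq_one {n : ℕ} {Out : Type} (A : Algorithm n Out) {E : A.Randomness → Prop}
    (h : ∀ ω, E ω) : A.prob E = 1 := by
  have : Nat.card {ω : A.Randomness // E ω} = Nat.card A.Randomness :=
    Nat.card_congr (Equiv.subtypeUnivEquiv h)
  rw [prob, this, div_self]
  exact_mod_cast Nat.card_pos.ne'

theorem two_pow_two_pow_floor_le {n : ℕ} (h : 0 ≤ Real.logb 2 (Real.logb 2 n))
    (h' : 0 < Real.logb 2 (n : ℝ)) : 2 ^ 2 ^ ⌊Real.logb 2 (Real.logb 2 n)⌋₊ ≤ n := by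
  have hn : (0 : ℝ) < n := by
    rcases Nat.eq_zero_or_pos n with rfl | hn
    · simp at h'
    · exact_mod_cast hn
  have h1 := Nat.floor_le h
  rw [Real.le_logb_iff_rpow_le one_lt_two h', Real.rpow_natCast] at h1
  rw [Real.le_logb_iff_rpow_le one_lt_two hn] at h1
  exact_mod_cast h1

theorem tendsto_logb_logb_atTop :
    Filter.Tendsto (fun n : ℕ => Real.logb 2 (Real.logb 2 n)) Filter.atTop Filter.atTop :=
  (Real.tendsto_logb_atTop one_lt_two).comp
    ((Real.tendsto_logb_atTop one_lt_two).comp tendsto_natCast_atTop_atTop)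

theorem exists_algorithm (n : ℕ) :
    ∃ A : Algorithm n (KnownPartition n), A.rounds ≤ 3 ∧ A.bandwidth ≤ 4 * Nat.log 2 n ∧
      (9 ≤ Real.logb 2 (Real.logb 2 n) → 0 < Real.logb 2 (n : ℝ) → ∀ G : SimpleGraph (Fin n),
        (∀ v, ((G.neighborSet v).ncard : ℝ) ≤ Real.logb 2 (Real.logb 2 n)) → ∀ ω v,
          (A.result G ω v).IsPartitionOf G ∧
          ((A.result G ω v).activeCount G : ℝ) ≤ n / Real.logb 2 (Real.logb 2 n)) := by
  by_cases h : 9 ≤ Real.logb 2 (Real.logb 2 n) ∧ 0 < Real.logb 2 (n : ℝ)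
  · obtain ⟨A, hr, hb, hA⟩ := exists_algorithm_of_degree_le
      (Nat.le_floor (by exact_mod_cast h.1)) (two_pow_two_pow_floor_le (by linarith) h.2)
    refine ⟨A, hr.le, hb.le, fun _ _ G hG ω v => ?_⟩
    obtain ⟨h1, h2⟩ := hA G (fun v => Nat.le_floor (hG v)) ω v
    refine ⟨h1, ?_⟩
    rw [le_div_iff₀ (by linarith)]
    -- Rounding down is harmless because the count carries the factor `q + 1`, which exceeds `log
    -- log n`.
    calc _ ≤ ((A.result G ω v).activeCount G : ℝ) * (⌊Real.logb 2 (Real.logb 2 n)⌋₊ + 1) := by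
          gcongr
          exact (Nat.lt_floor_add_one _).le
      _ ≤ n := by exact_mod_cast h2
  -- For small `n` a silent algorithm with bandwidth 0 respects the round and bandwidth bounds,
  -- which hold for every `n`.
  · exact ⟨⟨0, 0, 0, fun _ _ _ _ _ => ⟨[], le_rfl⟩, fun _ _ _ _ => .ofPointers id⟩, by simp, by simp,
      fun h1 h2 => absurd ⟨h1, h2⟩ h⟩

end CongestedClique

theorem mainTheorem5 :
    ∃ (R : ℕ) (K M : ℝ)
      (A : ∀ n : ℕ, CongestedClique.Algorithm n (CongestedClique.KnownPartition n))
      (coordinator : ∀ n : ℕ, 0 < n → Fin n),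
      (∀ n : ℕ, (A n).rounds ≤ R ∧ ((A n).bandwidth : ℝ) ≤ K * Real.logb 2 (n : ℝ)) ∧
      ∀ c : ℕ, ∃ N : ℕ, ∀ (n : ℕ) (hn : 0 < n), N ≤ n →
        ∀ (G : SimpleGraph (Fin n)) [DecidableRel G.Adj],
          (∀ v : Fin n, (G.degree v : ℝ) ≤ Real.logb 2 (Real.logb 2 (n : ℝ))) →
          1 - 1 / (n : ℝ) ^ c ≤ (A n).prob (fun ω =>
            ((A n).result G ω (coordinator n hn)).IsPartitionOf G ∧
            (((A n).result G ω (coordinator n hn)).activeCount G : ℝ) ≤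
              M * ((n : ℝ) / Real.logb 2 (Real.logb 2 (n : ℝ)))) := by
  choose A hrounds hbandwidth hA using CongestedClique.exists_algorithm
  refine ⟨3, 4, 1, A, fun n hn => ⟨0, hn⟩, fun n => ⟨hrounds n, ?_⟩, fun c => ?_⟩
  · calc ((A n).bandwidth : ℝ) ≤ 4 * (Nat.log 2 n : ℝ) := by exact_mod_cast hbandwidth n
      _ ≤ 4 * Real.logb 2 (n : ℝ) := by
          have := Real.natLog_le_logb n 2
          push_cast at this
          linarith
  · obtain ⟨N, hN⟩ := Filter.eventually_atTop.mp
      ((CongestedClique.tendsto_logb_logb_atTop.eventually_ge_atTop 9).and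
        (((Real.tendsto_logb_atTop one_lt_two).comp
          tendsto_natCast_atTop_atTop).eventually_gt_atTop 0))
    refine ⟨N, fun n hn hNn G _ hdeg => ?_⟩
    -- The event holds for every `ω`, so one `N` serves all `c`.
    rw [CongestedClique.Algorithm.prob_eq_one]
    · have : (0 : ℝ) ≤ 1 / (n : ℝ) ^ c := by positivity
      linarith
    · intro ω
      rw [one_mul]
      refine hA n (hN n hNn).1 (hN n hNn).2 G (fun v => ?_) ω _
      rw [← Nat.card_coe_set_eq, Nat.card_eq_fintype_card, SimpleGraph.card_neighborSet_eq_degree]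
      exact hdeg v
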